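/- Let $d\ge 1$ and $n\ge 0$ be integers. For a field $k$ consider the polynomial $$P_n=\sum_{i=1}^n x_i^1x_i^2\cdots x_i^d$$ in the $nd$ variables $x_i^j$ ($1\le i\le n$, $1\le j\le d$; upper indices are not exponents), viewed as a function on $\mathbb V_n=(\mathbb A^d)^n$, and let $\mathbb X_n=\{P_n=0\}\subset\mathbb V_n$. For a field extension $l/k$ let $\mathbb X_n(l)\subset \mathbb V_n(l)=l^{nd}$ be the set of $l$-points of $\mathbb X_n$. The rank $r_k(P)$ of a polynomial $P$ over $k$ is the minimal $r$ such that $P=\sum_{i=1}^r Q_iR_i$ with polynomials $Q_i,R_i$ over $k$ of degree strictly smaller than $\deg P$ (and $\infty$ if there is no such representation). For a subset $X$ of a finite-dimensional coordinate space $V$ over a field $l$, a function $f:X\to l$ is weakly polynomial of degree $\le a$ if its restriction to every affine subspace $L\subset V$ contained in $X$ is a polynomial of degree $\le a$. Given $a\ge 1$ (and $d$), a field $k$ is admissible if $|k|>ad$, $k$ contains a root of unity of order $m$ for some $m>2a$, and $\operatorname{char} k=0$ or $\operatorname{char} k>d$. (1) For every field $k$, $r_k(P_n)\ge n/d$. (2)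 For every integer $a\ge 1$ and every admissible field $k$, the hypersurface $\mathbb X_n$ has the property $\star_a$: for every finite extension $l/k$, every weakly polynomial function $\mathbb X_n(l)\to l$ of degree $\le a$ is the restriction of a polynomial of degree $\le a$ on $\mathbb V_n(l)$. In particular, the weakly polynomial functions of degree $\le a$ on $\mathbb X_n(k)$ are exactly the restrictions to $\mathbb X_n(k)$ of polynomials of degree $\le a$ on $\mathbb V_n(k)$. -/

import Mathlib

universe u v

/-- The admissible fields, for given `a` and `d`: `|k| > a d`, the field `k` contains a root of
unity of (exact) order `m > 2 a`, and the characteristic of `k` is `0` or greater than `d`. -/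
structure IsAdmissibleField (a d : ℕ) (k : Type u) [Field k] : Prop where
  card_gt : ((a * d : ℕ) : ℕ∞) < ENat.card k
  exists_root : ∃ (m : ℕ) (β : k), 2 * a < m ∧ IsPrimitiveRoot β m
  char_gt : ringChar k = 0 ∨ d < ringChar k

/-- A function `f : S → k` on a subset `S` of the coordinate space `k^σ` is polynomial of degree
`≤ a` if it is the restriction to `S` of a polynomial of degree `≤ a` on `k^σ`. (When `S` is an
affine subspace this is the same as being a polynomial of degree `≤ a` in affine coordinates
on `S`.) -/
def IsPolynomialOfDegreeLE {k : Type u} [Field k] {σ : Type v} (a : ℕ) {S : Set (σ → k)}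
    (f : S → k) : Prop :=
  ∃ F : MvPolynomial σ k, F.totalDegree ≤ a ∧ ∀ x : S, f x = MvPolynomial.eval (x : σ → k) F

/-- `f : X → k` is weakly polynomial of degree `≤ a` if its restriction to every affine subspace
`L ⊆ X` is a polynomial of degree `≤ a`. -/
def IsWeaklyPolynomialOfDegreeLE {k : Type u} [Field k] {σ : Type v} (a : ℕ) {X : Set (σ → k)}
    (f : X → k) : Prop :=
  ∀ (L : AffineSubspace k (σ → k)) (hL : (L : Set (σ → k)) ⊆ X),
    IsPolynomialOfDegreeLE a (f ∘ Set.inclusion hL)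

/-- The property `⋆ᵏ_a` of a subset `X` of `k^σ`: every weakly polynomial function of degree `≤ a`
on `X` is the restriction of a polynomial of degree `≤ a`. -/
def SatisfiesStarOver {k : Type u} [Field k] {σ : Type v} (a : ℕ) (X : Set (σ → k)) : Prop :=
  ∀ f : X → k, IsWeaklyPolynomialOfDegreeLE a f → IsPolynomialOfDegreeLE a f

/-- The set of `l`-points of the hypersurface `{P = 0}`, for `l` an extension of `k`. -/
def hypersurfacePoints {k : Type u} [Field k] {σ : Type v} (P : MvPolynomial σ k)
    (l : Type u) [Field l] [Algebra k l] : Set (σ → l) :=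
  {x | MvPolynomial.aeval x P = 0}

/-- The property `⋆_a` of the hypersurface `{P = 0}`: for every finite extension `l` of `k`, its
set of `l`-points satisfies `⋆ˡ_a`. -/
def SatisfiesStar {k : Type u} [Field k] {σ : Type v} (a : ℕ) (P : MvPolynomial σ k) : Prop :=
  ∀ (l : Type u) [Field l] [Algebra k l] [FiniteDimensional k l],
    SatisfiesStarOver a (hypersurfacePoints P l)

/-- The algebraic rank (Schmidt `h`-invariant) of `P` over `k`: the minimal `r` such that
`P = ∑_{i=1}^r Q_i R_i` with all `Q_i`, `R_i` of degree strictly smaller than `deg P`; it is `∞` if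
there is no such representation. -/
noncomputable def algebraicRank {k : Type u} [Field k] {σ : Type v} (P : MvPolynomial σ k) : ℕ∞ :=
  ⨅ (r : ℕ) (_ : ∃ Q R : Fin r → MvPolynomial σ k,
    (∀ i, (Q i).totalDegree < P.totalDegree) ∧ (∀ i, (R i).totalDegree < P.totalDegree) ∧
      P = ∑ i, Q i * R i), (r : ℕ∞)

/-- `P_n = ∑_{i=1}^n x_i^1 ⋯ x_i^d` on `(𝔸^d)^n`; the variable `(i, j)` is `x_i^j`. -/
noncomputable def polyP (k : Type u) [Field k] (n d : ℕ) : MvPolynomial (Fin n × Fin d) k :=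
  ∑ i : Fin n, ∏ j : Fin d, MvPolynomial.X (i, j)

/-! Rank. If `P_n` is a sum of `r` products `Q_i * R_i` of polynomials of smaller degree, its degree
`d` part lies in `I ^ 2`, where `I` is generated by the at most `2r(d-1)` homogeneous components of
the factors in degrees `1, …, d-1`. By Leibniz, all partial derivatives of `P_n` lie in `I`. By
Krull's height theorem a minimal prime over `I` has height at most `2r(d-1)`; but it contains every
`∏_{j' ≠ j} x_i^{j'}`, hence two variables of each block, so its height is at least `2n`.

Property `⋆_a`, for `n ≥ 2`. For `J : Fin n → Fin d`, scaling coordinate `J i` of each block `i` by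
`t` multiplies all block products by `t`, so it preserves `X_n`. Taking `t = β` of order `m` gives
commuting operators of order `m`, and it suffices to treat common eigenfunctions `g`. Orbits in `t`
lie on affine lines in `X_n`, so `g` scales by `t ^ e J` with `e J ≤ a`. Since `m > 2a`, relations
in the torus become exact relations between weights: `e J = e J₀ + ∑ w_i (J i)` with `w ≥ 0`.
Dilating all coordinates gives `∑_j e (j, …, j) ≤ a`.

On the affine subspace where coordinates off `J₀` equal `1`, `g` is a form `P` of degree `e J₀` in
the block products. The candidate extension is `F = ∏ x ^ w * P(block products)`, of degree at most
`d * e J₀ + ∑ w = ∑_j e (j, …, j) ≤ a`. Now `g - F` vanishes on this section, hence, by torus moves,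
at all points of `X_n` with nonzero coordinates, and finally, along lines in `X_n`, everywhere on it
(`eq_zero_of_vanish_of_ne_zero`). -/

/-! ### The rank bound, by heights of ideals. -/

open MvPolynomial in
/-- Setting the variables in `S` to zero. -/
noncomputable def killVars {R : Type*} [CommRing R] {σ : Type*} (S : Finset σ) :
    MvPolynomial σ R →ₐ[R] MvPolynomial σ R := by
  classical exact aeval fun i => if i ∈ S then 0 else X i

open MvPolynomial in
theorem killVars_X {R : Type*} [CommRing R] {σ : Type*} [DecidableEq σ] (S : Finset σ) (i : σ) :
    killVars (R := R) S (X i) = if i ∈ S then 0 else X i := by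
  simp only [killVars, aeval_X]
  congr

open MvPolynomial in
-- Killing the variables one at a time gives a strictly increasing chain of prime kernels.
theorem card_le_height_ker_killVars {R : Type*} [CommRing R] [IsDomain R] {σ : Type*}
    (S : Finset σ) : (S.card : ℕ∞) ≤ (RingHom.ker (killVars (R := R) S)).height := by
  classical
  induction S using Finset.induction_on with
  | empty => simp
  | insert i S hi ih =>
    have h1 : (RingHom.ker (killVars (R := R) S)).IsPrime := RingHom.ker_isPrime _
    have h2 : (RingHom.ker (killVars (R := R) (insert i S))).IsPrime := RingHom.ker_isPrime _
    have hcomp : (killVars (R := R) (insert i S)).comp (killVars S) = killVars (insert i S) := by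
      apply algHom_ext
      intro j
      simp only [AlgHom.comp_apply, killVars_X]
      split_ifs with h h' <;> simp_all [killVars_X]
    have hlt : RingHom.ker (killVars (R := R) S) < RingHom.ker (killVars (R := R) (insert i S)) := by
      refine lt_of_le_of_ne (fun x hx => ?_) fun h => ?_
      · rw [RingHom.mem_ker] at hx ⊢
        rw [← hcomp, AlgHom.comp_apply, hx, map_zero]
      · have : (X i : MvPolynomial σ R) ∈ RingHom.ker (killVars (R := R) S) := by
          rw [h, RingHom.mem_ker, killVars_X]
          simp
        rw [RingHom.mem_ker, killVars_X, if_neg hi] at this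
        exact X_ne_zero i this
    rw [Finset.card_insert_of_notMem hi]
    push_cast
    exact (add_le_add_left ih 1).trans (Ideal.height_add_one_le_of_lt_of_isPrime hlt)

open MvPolynomial in
-- Modulo `p` the substitution `killVars S` is the identity, so its kernel is contained in `p`.
theorem card_le_height_of_X_mem {R : Type*} [CommRing R] [IsDomain R] {σ : Type*}
    (S : Finset σ) (p : Ideal (MvPolynomial σ R)) (h : ∀ i ∈ S, X i ∈ p) :
    (S.card : ℕ∞) ≤ p.height := by
  classical
  refine (card_le_height_ker_killVars S).trans (Ideal.height_mono fun x hx => ?_)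
  have hcomp : (Ideal.Quotient.mkₐ R p).comp (killVars S) = Ideal.Quotient.mkₐ R p := by
    apply algHom_ext
    intro j
    simp only [AlgHom.comp_apply, killVars_X]
    split_ifs with hj
    · rw [map_zero, Ideal.Quotient.mkₐ_eq_mk, eq_comm, Ideal.Quotient.eq_zero_iff_mem]
      exact h j hj
    · rfl
  have := DFunLike.congr_fun hcomp x
  rw [RingHom.mem_ker] at hx
  rw [AlgHom.comp_apply, hx, map_zero, Ideal.Quotient.mkₐ_eq_mk, eq_comm,
    Ideal.Quotient.eq_zero_iff_mem] at this
  exact this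

open MvPolynomial in
theorem pderiv_mem_of_mem_sq {R : Type*} [CommRing R] {σ : Type*}
    {I : Ideal (MvPolynomial σ R)} {f : MvPolynomial σ R} (hf : f ∈ I ^ 2) (s : σ) :
    pderiv s f ∈ I := by
  rw [pow_two] at hf
  induction hf using Submodule.mul_induction_on' with
  | mem_mul_mem x hx y hy =>
    rw [Derivation.leibniz]
    exact I.add_mem (I.mul_mem_right _ hx) (I.mul_mem_right _ hy)
  | add x _ y _ hx hy =>
    rw [map_add]
    exact I.add_mem hx hy

open MvPolynomial in
/-- The degree `d` component of a product of two polynomials of degree `< d` lies in the square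
of any ideal containing their components of degrees `1, …, d - 1`. -/
theorem homogeneousComponent_mul_mem_sq {R : Type*} [CommRing R] {σ : Type*}
    {I : Ideal (MvPolynomial σ R)} {d : ℕ} {q r : MvPolynomial σ R} (hq : q.totalDegree < d)
    (hr : r.totalDegree < d)
    (hqI : ∀ c ∈ Finset.Ioo 0 d, homogeneousComponent c q ∈ I)
    (hrI : ∀ c ∈ Finset.Ioo 0 d, homogeneousComponent c r ∈ I) :
    homogeneousComponent d (q * r) ∈ I ^ 2 := by
  rw [← sum_homogeneousComponent q, ← sum_homogeneousComponent r, Finset.sum_mul_sum, map_sum]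
  refine Ideal.sum_mem _ fun s hs => ?_
  rw [map_sum]
  refine Ideal.sum_mem _ fun t ht => ?_
  rw [Finset.mem_range] at hs ht
  rw [homogeneousComponent_of_mem ((mem_homogeneousSubmodule _ _).2
    ((homogeneousComponent_isHomogeneous s q).mul (homogeneousComponent_isHomogeneous t r)))]
  split_ifs with h
  -- `s + t = d` with `s, t < d` forces both degrees to be positive.
  · rw [pow_two]
    exact Ideal.mul_mem_mul (hqI _ (Finset.mem_Ioo.2 ⟨by omega, by omega⟩))
      (hrI _ (Finset.mem_Ioo.2 ⟨by omega, by omega⟩))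
  · exact Ideal.zero_mem _

open MvPolynomial in
theorem polyP_isHomogeneous (k : Type u) [Field k] (n d : ℕ) : (polyP k n d).IsHomogeneous d := by
  refine IsHomogeneous.sum _ _ _ fun i _ => ?_
  have := IsHomogeneous.prod (Finset.univ : Finset (Fin d))
    (fun j => (X (i, j) : MvPolynomial (Fin n × Fin d) k)) (fun _ => 1) fun j _ => isHomogeneous_X _ _
  simpa using this

open MvPolynomial in
theorem pderiv_prod_X_of_notMem {k : Type u} [Field k] {σ ι : Type*} (T : Finset ι) (g : ι → σ)
    (s : σ) (h : ∀ j ∈ T, g j ≠ s) :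
    pderiv s (∏ j ∈ T, (X (g j) : MvPolynomial σ k)) = 0 := by
  classical
  induction T using Finset.induction_on with
  | empty => simp
  | insert a T ha ih =>
    rw [Finset.prod_insert ha, Derivation.leibniz, ih fun j hj => h j (Finset.mem_insert_of_mem hj),
      pderiv_X_of_ne (h a (Finset.mem_insert_self _ _))]
    simp

open MvPolynomial in
theorem pderiv_polyP (k : Type u) [Field k] (n d : ℕ) (i : Fin n) (j : Fin d) :
    pderiv (i, j) (polyP k n d) = ∏ j' ∈ Finset.univ.erase j, X (i, j') := by
  classical
  rw [polyP, map_sum, Finset.sum_eq_single i]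
  · rw [← Finset.mul_prod_erase _ _ (Finset.mem_univ j), Derivation.leibniz,
      pderiv_prod_X_of_notMem _ _ _ fun j' hj' h => ?_]
    · simp
    · exact (Finset.ne_of_mem_erase hj') (Prod.ext_iff.1 h).2
  · intro i' _ hi'
    exact pderiv_prod_X_of_notMem _ _ _ fun j' _ h => hi' (Prod.ext_iff.1 h).1
  · simp

open MvPolynomial in
/-- A prime containing all partial derivatives of `P_n` contains two variables of each block. -/
theorem two_mul_le_height_of_pderiv_mem (k : Type u) [Field k] (n d : ℕ)
    (hd : 1 ≤ d) (p : Ideal (MvPolynomial (Fin n × Fin d) k)) [hp : p.IsPrime]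
    (h : ∀ s, pderiv s (polyP k n d) ∈ p) : ((2 * n : ℕ) : ℕ∞) ≤ p.height := by
  classical
  have step : ∀ (i : Fin n) (j : Fin d), ∃ j' ≠ j, (X (i, j') : MvPolynomial _ k) ∈ p := by
    intro i j
    have := h (i, j)
    rw [pderiv_polyP, hp.prod_mem_iff] at this
    obtain ⟨j', hj', hm⟩ := this
    exact ⟨j', Finset.ne_of_mem_erase hj', hm⟩
  -- `g i j0` and `g i (g i j0)` are two distinct indices in block `i`.
  choose g hg hgp using step
  let j0 : Fin d := ⟨0, hd⟩
  let φ : Fin n × Fin 2 → Fin n × Fin d :=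
    fun s => (s.1, if s.2 = 0 then g s.1 j0 else g s.1 (g s.1 j0))
  have hφ : Function.Injective φ := by
    rintro ⟨i, c⟩ ⟨i', c'⟩ h
    simp only [φ, Prod.mk.injEq] at h
    obtain ⟨rfl, h2⟩ := h
    have := hg i (g i j0)
    congr 1
    fin_cases c <;> fin_cases c' <;> simp_all
    exact hg _ _ h2.symm
  have := card_le_height_of_X_mem (Finset.univ.map ⟨φ, hφ⟩) p (by
    intro s hs
    obtain ⟨⟨i, c⟩, -, rfl⟩ := Finset.mem_map.1 hs
    simp only [φ, Function.Embedding.coeFn_mk]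
    split_ifs
    · exact hgp _ _
    · exact hgp _ _)
  rw [Finset.card_map, Finset.card_univ, Fintype.card_prod, Fintype.card_fin, Fintype.card_fin,
    mul_comm] at this
  exact this

open MvPolynomial in
theorem le_mul_of_polyP_eq_sum (k : Type u) [Field k] (n d r : ℕ) (hd : 1 ≤ d)
    (Q R : Fin r → MvPolynomial (Fin n × Fin d) k)
    (hQ : ∀ i, (Q i).totalDegree < (polyP k n d).totalDegree)
    (hR : ∀ i, (R i).totalDegree < (polyP k n d).totalDegree)
    (hP : polyP k n d = ∑ i, Q i * R i) : n ≤ r * d := by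
  classical
  have hPd : (polyP k n d).totalDegree ≤ d := (polyP_isHomogeneous k n d).totalDegree_le
  let T : Finset (MvPolynomial (Fin n × Fin d) k) :=
    (Finset.univ ×ˢ Finset.Ioo 0 d).image (fun s : Fin r × ℕ => homogeneousComponent s.2 (Q s.1)) ∪
    (Finset.univ ×ˢ Finset.Ioo 0 d).image (fun s : Fin r × ℕ => homogeneousComponent s.2 (R s.1))
  have hT : T.card ≤ 2 * (r * (d - 1)) := by
    refine (Finset.card_union_le _ _).trans ?_
    have := Finset.card_image_le (s := Finset.univ ×ˢ Finset.Ioo 0 d)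
      (f := fun s : Fin r × ℕ => homogeneousComponent s.2 (Q s.1))
    have := Finset.card_image_le (s := Finset.univ ×ˢ Finset.Ioo 0 d)
      (f := fun s : Fin r × ℕ => homogeneousComponent s.2 (R s.1))
    simp only [Finset.card_product, Finset.card_univ, Fintype.card_fin, Nat.card_Ioo,
      Nat.sub_zero] at *
    omega
  have hQI : ∀ i, ∀ c ∈ Finset.Ioo 0 d, homogeneousComponent c (Q i) ∈ Ideal.span (T : Set (MvPolynomial (Fin n × Fin d) k)) :=
    fun i c hc => Ideal.subset_span (Finset.mem_union_left _
      (Finset.mem_image.2 ⟨(i, c), by simpa using hc, rfl⟩))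
  have hRI : ∀ i, ∀ c ∈ Finset.Ioo 0 d, homogeneousComponent c (R i) ∈ Ideal.span (T : Set (MvPolynomial (Fin n × Fin d) k)) :=
    fun i c hc => Ideal.subset_span (Finset.mem_union_right _
      (Finset.mem_image.2 ⟨(i, c), by simpa using hc, rfl⟩))
  have hmem : polyP k n d ∈ Ideal.span (T : Set (MvPolynomial (Fin n × Fin d) k)) ^ 2 := by
    have : polyP k n d = homogeneousComponent d (polyP k n d) := by
      rw [homogeneousComponent_of_mem ((mem_homogeneousSubmodule _ _).2 (polyP_isHomogeneous k n d)),
        if_pos rfl]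
    rw [this, hP, map_sum]
    exact Ideal.sum_mem _ fun i _ => homogeneousComponent_mul_mem_sq ((hQ i).trans_le hPd)
      ((hR i).trans_le hPd) (hQI i) (hRI i)
  have hne : Ideal.span (T : Set (MvPolynomial (Fin n × Fin d) k)) ≠ ⊤ := by
    have hle : Ideal.span (T : Set (MvPolynomial (Fin n × Fin d) k)) ≤ RingHom.ker (constantCoeff (σ := Fin n × Fin d) (R := k)) := by
      have aux : ∀ (c : ℕ) (q : MvPolynomial (Fin n × Fin d) k), c ∈ Finset.Ioo 0 d →
          constantCoeff (homogeneousComponent c q) = 0 := by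
        intro c q hc
        rw [constantCoeff_eq, coeff_homogeneousComponent, if_neg]
        simp only [Finset.mem_Ioo] at hc
        simpa using hc.1.ne
      rw [Ideal.span_le]
      intro x hx
      rcases Finset.mem_union.1 (Finset.mem_coe.1 hx) with hx | hx <;>
      · obtain ⟨⟨i, c⟩, hc, rfl⟩ := Finset.mem_image.1 hx
        exact aux _ _ (Finset.mem_product.1 hc).2
    intro h
    rw [h, top_le_iff] at hle
    exact (RingHom.ker_isPrime (constantCoeff (σ := Fin n × Fin d) (R := k))).ne_top hle
  -- Krull's theorem bounds the height of a minimal prime over the span of `T` by the size of `T`.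
  obtain ⟨p, hp⟩ := Ideal.nonempty_minimalPrimes hne
  have := hp.1.1
  have h1 := two_mul_le_height_of_pderiv_mem k n d hd p fun s => hp.1.2 (pderiv_mem_of_mem_sq hmem s)
  have h2 := h1.trans (Ideal.height_le_card_of_mem_minimalPrimes_span_finset hp)
  have h3 : 2 * n ≤ T.card := by exact_mod_cast h2
  have h4 : r * (d - 1) ≤ r * d := Nat.mul_le_mul_left _ (Nat.sub_le _ _)
  omega

theorem div_le_algebraicRank_polyP (k : Type u) [Field k] (n d : ℕ) (hd : 1 ≤ d) :
    (n : ENNReal) / (d : ENNReal) ≤ ((algebraicRank (polyP k n d) : ℕ∞) : ENNReal) := by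
  -- The ceiling of `n / d` keeps the comparison with the infimum in `ℕ∞`.
  have h : (((n + d - 1) / d : ℕ) : ℕ∞) ≤ algebraicRank (polyP k n d) := by
    refine le_iInf₂ fun r hr => ?_
    obtain ⟨Q, R, hQ, hR, hP⟩ := hr
    have := le_mul_of_polyP_eq_sum k n d r hd Q R hQ hR hP
    norm_cast
    rw [Nat.div_le_iff_le_mul_add_pred hd]
    have h2 := mul_comm r d
    omega
  have h' : (((n + d - 1) / d : ℕ) : ENNReal) ≤ ((algebraicRank (polyP k n d) : ℕ∞) : ENNReal) := by
    exact_mod_cast h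
  refine le_trans ?_ h'
  rw [ENNReal.div_le_iff (by simp; omega) (by simp)]
  norm_cast
  have := Nat.div_add_mod (n + d - 1) d
  have := Nat.mod_lt (n + d - 1) hd
  have h2 := mul_comm ((n + d - 1) / d) d
  omega

/-! ### Polynomials, substitutions and large finite subsets of the field. -/

theorem Polynomial.eq_of_natDegree_le_of_eval_eq {k : Type u} [Field k] {p q : Polynomial k} {N : ℕ}
    (hp : p.natDegree ≤ N) (hq : q.natDegree ≤ N) {T : Finset k} (hT : N < T.card)
    (h : ∀ t ∈ T, p.eval t = q.eval t) : p = q := by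
  rw [← sub_eq_zero]
  refine Polynomial.eq_zero_of_natDegree_lt_card_of_eval_eq_zero' (p - q) T
    (fun t ht => by rw [Polynomial.eval_sub, h t ht, sub_self]) ?_
  exact ((Polynomial.natDegree_sub_le p q).trans (max_le hp hq)).trans_lt hT

open MvPolynomial in
theorem MvPolynomial.totalDegree_aeval_le {k : Type u} [Field k] {σ τ : Type*}
    (F : MvPolynomial σ k) (g : σ → MvPolynomial τ k) {D : ℕ} (hg : ∀ i, (g i).totalDegree ≤ D) :
    (aeval g F).totalDegree ≤ F.totalDegree * D := by
  rw [aeval_def, eval₂_eq]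
  refine totalDegree_finsetSum_le fun m hm => ?_
  refine (totalDegree_mul _ _).trans ?_
  rw [algebraMap_eq, totalDegree_C, zero_add]
  refine (totalDegree_finsetProd _ _).trans ?_
  calc ∑ i ∈ m.support, (g i ^ m i).totalDegree ≤ ∑ i ∈ m.support, m i * D :=
        Finset.sum_le_sum fun i _ =>
          (totalDegree_pow _ _).trans (Nat.mul_le_mul_left _ (hg i))
    _ = (∑ i ∈ m.support, m i) * D := by rw [Finset.sum_mul]
    _ ≤ F.totalDegree * D := Nat.mul_le_mul_right _ (le_totalDegree hm)

theorem MvPolynomial.eval_aeval_eq {k : Type u} [Field k] {σ τ : Type*} (F : MvPolynomial σ k)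
    (g : σ → MvPolynomial τ k) (y : τ → k) :
    eval y (aeval g F) = eval (fun i => eval y (g i)) F := by
  induction F using MvPolynomial.induction_on <;> simp_all

theorem MvPolynomial.polynomial_eval_aeval {k : Type u} [Field k] {σ : Type*}
    (F : MvPolynomial σ k) (g : σ → Polynomial k) (t : k) :
    (aeval g F).eval t = eval (fun i => (g i).eval t) F := by
  induction F using MvPolynomial.induction_on <;> simp_all

theorem exists_finset_lt_card {k : Type u} {N : ℕ} (h : (N : ℕ∞) < ENat.card k) :
    ∃ T : Finset k, N < T.card := by
  rcases finite_or_infinite k with hk | hk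
  · have := Fintype.ofFinite k
    refine ⟨Finset.univ, ?_⟩
    rw [ENat.card_eq_coe_fintype_card] at h
    exact_mod_cast h
  · obtain ⟨T, hT⟩ := Infinite.exists_subset_card_eq k (N + 1)
    exact ⟨T, by omega⟩

/-- The `m` powers of `β` together with `0`. -/
theorem IsPrimitiveRoot.exists_finset_lt_card {k : Type u} [Field k] {β : k} {m : ℕ}
    (hβ : IsPrimitiveRoot β m) (hm : 0 < m) : ∃ T : Finset k, m < T.card := by
  classical
  refine ⟨insert 0 ((Finset.range m).image (β ^ ·)), ?_⟩
  rw [Finset.card_insert_of_notMem, Finset.card_image_of_injOn, Finset.card_range]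
  · omega
  · intro i hi j hj h
    exact hβ.pow_inj (Finset.mem_range.1 hi) (Finset.mem_range.1 hj) h
  · intro h
    obtain ⟨i, -, hi⟩ := Finset.mem_image.1 h
    exact hβ.ne_zero hm.ne' (eq_zero_of_pow_eq_zero hi)

/-! ### Simultaneous diagonalization. -/

/-- Simultaneous diagonalization of commuting endomorphisms of order `m`: a submodule stable under
them is contained in `P` as soon as its common eigenvectors are. -/
theorem le_of_forall_commonEigenvector_mem {k : Type u} [Field k] {β : k} {m : ℕ}
    (hβ : IsPrimitiveRoot β m) (hm : 0 < m) {V : Type*} [AddCommGroup V] [Module k V]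
    {ι : Type*} [Finite ι] (U : ι → Module.End k V) (hcomm : ∀ i j, Commute (U i) (U j))
    (hU : ∀ i, U i ^ m = 1) (W P : Submodule k V) (hW : ∀ i, ∀ v ∈ W, U i v ∈ W)
    (h : ∀ v ∈ W, (∀ i, ∃ ζ : k, U i v = ζ • v) → v ∈ P) : W ≤ P := by
  classical
  have := Fintype.ofFinite ι
  have hm0 : NeZero m := ⟨hm.ne'⟩
  have hmk : (m : k) ≠ 0 := (hβ.neZero').ne
  have hβ0 : β ≠ 0 := hβ.ne_zero hm.ne'
  -- `s` collects the operators for which `v` need not yet be an eigenvector.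
  suffices H : ∀ s : Finset ι, ∀ v ∈ W, (∀ i ∉ s, ∃ ζ : k, U i v = ζ • v) → v ∈ P from
    fun v hv => H Finset.univ v hv fun i hi => absurd (Finset.mem_univ i) hi
  intro s
  induction s using Finset.induction_on with
  | empty => exact fun v hv h' => h v hv fun i => h' i (Finset.notMem_empty i)
  | insert i s hi ih =>
    intro v hv hs
    have hWp : ∀ q : ℕ, (U i ^ q) v ∈ W := by
      intro q
      induction q with
      | zero => simpa using hv
      | succ q hq => rw [pow_succ', Module.End.mul_apply]; exact hW i _ hq
    -- `c r` is `m` times the projection of `v` to the `β ^ r`-eigenspace of `U i`.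
    let c : ℕ → V := fun r => ∑ q ∈ Finset.range m, (β⁻¹ ^ r) ^ q • (U i ^ q) v
    have hcW : ∀ r, c r ∈ W := fun r => W.sum_mem fun q _ => W.smul_mem _ (hWp q)
    have hci : ∀ r, U i (c r) = β ^ r • c r := by
      intro r
      have hz : (β⁻¹ ^ r) ^ m = 1 := by
        rw [← pow_mul, mul_comm, pow_mul, inv_pow, hβ.pow_eq_one, inv_one, one_pow]
      have e1 : (β⁻¹ ^ r) • U i (c r) = c r := by
        have hs1 := Finset.sum_range_succ (fun q => (β⁻¹ ^ r) ^ q • (U i ^ q) v) m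
        have hs2 := Finset.sum_range_succ' (fun q => (β⁻¹ ^ r) ^ q • (U i ^ q) v) m
        rw [hs1, hz, hU i] at hs2
        simp only [pow_zero] at hs2
        have hs3 := add_right_cancel hs2
        refine Eq.trans ?_ hs3.symm
        simp only [c, map_sum, Finset.smul_sum, map_smul, smul_smul, ← Module.End.mul_apply,
          ← pow_succ']
      rw [← e1, smul_smul, ← mul_pow, mul_inv_cancel₀ hβ0, one_pow, one_smul, e1]
    have hcP : ∀ r, c r ∈ P := by
      intro r
      refine ih (c r) (hcW r) fun j hj => ?_
      by_cases hji : j = i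
      · subst hji
        exact ⟨_, hci r⟩
      · obtain ⟨ζ, hζ⟩ := hs j (by simp [hji, hj])
        refine ⟨ζ, ?_⟩
        simp only [c, map_sum, Finset.smul_sum, map_smul]
        refine Finset.sum_congr rfl fun q _ => ?_
        rw [← Module.End.mul_apply, ((hcomm j i).pow_right q).eq, Module.End.mul_apply, hζ,
          map_smul, smul_comm]
    have hsum : ∑ r ∈ Finset.range m, c r = (m : k) • v := by
      simp only [c]
      rw [Finset.sum_comm, Finset.sum_eq_single_of_mem 0 (Finset.mem_range.2 hm)]
      · simp [← Nat.cast_smul_eq_nsmul k]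
      · intro q hq hq0
        rw [← Finset.sum_smul]
        have hz : β⁻¹ ^ q ≠ 1 := by
          rw [inv_pow]
          exact fun h' => hβ.pow_ne_one_of_pos_of_lt hq0 (Finset.mem_range.1 hq) (inv_eq_one.1 h')
        have hg := mul_neg_geom_sum (β⁻¹ ^ q) m
        rw [← pow_mul, mul_comm q m, pow_mul, inv_pow β m, hβ.pow_eq_one, inv_one, one_pow,
          sub_self] at hg
        have hg' := (mul_eq_zero.1 hg).resolve_left (sub_ne_zero.2 hz.symm)
        simp only [← pow_mul] at hg' ⊢
        simp only [mul_comm _ q, hg', zero_smul]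
    have : v = (m : k)⁻¹ • ∑ r ∈ Finset.range m, c r := by
      rw [hsum, smul_smul, inv_mul_cancel₀ hmk, one_smul]
    rw [this]
    exact P.smul_mem _ (P.sum_mem fun r _ => hcP r)

/-! ### Spaces of polynomial and weakly polynomial functions. -/

open MvPolynomial in
/-- The functions on `k^σ` whose restriction to `S` is polynomial of degree `≤ a`. -/
def polySubmodule {k : Type u} [Field k] {σ : Type v} (a : ℕ) (S : Set (σ → k)) :
    Submodule k ((σ → k) → k) where
  carrier := {g | ∃ F : MvPolynomial σ k, F.totalDegree ≤ a ∧ ∀ x ∈ S, g x = eval x F}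
  zero_mem' := ⟨0, by simp, by simp⟩
  add_mem' := by
    rintro f g ⟨F, hF, hf⟩ ⟨G, hG, hg⟩
    exact ⟨F + G, (totalDegree_add _ _).trans (max_le hF hG),
      fun x hx => by simp [hf x hx, hg x hx]⟩
  smul_mem' := by
    rintro c f ⟨F, hF, hf⟩
    exact ⟨c • F, (totalDegree_smul_le _ _).trans hF, fun x hx => by simp [hf x hx, smul_eval]⟩

/-- The functions on `k^σ` whose restriction to `X` is weakly polynomial of degree `≤ a`. -/
def weakPolySubmodule {k : Type u} [Field k] {σ : Type v} (a : ℕ) (X : Set (σ → k)) :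
    Submodule k ((σ → k) → k) :=
  ⨅ (L : AffineSubspace k (σ → k)) (_ : (L : Set (σ → k)) ⊆ X), polySubmodule a L

theorem mem_weakPolySubmodule {k : Type u} [Field k] {σ : Type v} {a : ℕ} {X : Set (σ → k)}
    {g : (σ → k) → k} : g ∈ weakPolySubmodule a X ↔
      ∀ L : AffineSubspace k (σ → k), (L : Set (σ → k)) ⊆ X → g ∈ polySubmodule a L := by
  simp [weakPolySubmodule, Submodule.mem_iInf]

theorem polySubmodule_le_weakPolySubmodule {k : Type u} [Field k] {σ : Type v} (a : ℕ)
    (X : Set (σ → k)) : polySubmodule a X ≤ weakPolySubmodule a X := by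
  rintro g ⟨F, hF, hg⟩
  exact mem_weakPolySubmodule.2 fun L hL => ⟨F, hF, fun x hx => hg x (hL hx)⟩

theorem satisfiesStarOver_of_le {k : Type u} [Field k] {σ : Type v} {a : ℕ} {X : Set (σ → k)}
    (h : weakPolySubmodule a X ≤ polySubmodule a X) : SatisfiesStarOver a X := by
  classical
  intro f hf
  -- Values off `X` are irrelevant to both submodules; `0` is a default.
  let g : (σ → k) → k := fun x => if hx : x ∈ X then f ⟨x, hx⟩ else 0
  have hg : ∀ x (hx : x ∈ X), g x = f ⟨x, hx⟩ := fun x hx => dif_pos hx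
  have hgw : g ∈ weakPolySubmodule a X := by
    rw [mem_weakPolySubmodule]
    intro L hL
    obtain ⟨F, hF, hFe⟩ := hf L hL
    refine ⟨F, hF, fun x hx => ?_⟩
    rw [hg x (hL hx)]
    exact hFe ⟨x, hx⟩
  obtain ⟨F, hF, hFe⟩ := h hgw
  exact ⟨F, hF, fun x => by rw [← hFe x x.2, hg]⟩

theorem IsPolynomialOfDegreeLE.isWeaklyPolynomialOfDegreeLE {k : Type u} [Field k] {σ : Type v}
    {a : ℕ} {X : Set (σ → k)} {f : X → k} (hf : IsPolynomialOfDegreeLE a f) :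
    IsWeaklyPolynomialOfDegreeLE a f := by
  obtain ⟨F, hF, hFe⟩ := hf
  exact fun L hL => ⟨F, hF, fun x => hFe (Set.inclusion hL x)⟩

/-- A weakly polynomial function is polynomial on every line contained in `X`. -/
theorem exists_polynomial_of_line_subset {k : Type u} [Field k] {σ : Type v} {a : ℕ}
    {X : Set (σ → k)} {g : (σ → k) → k} (hg : g ∈ weakPolySubmodule a X) (x v : σ → k)
    (h : ∀ t : k, x + t • v ∈ X) :
    ∃ q : Polynomial k, q.natDegree ≤ a ∧ ∀ t, g (x + t • v) = q.eval t := by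
  obtain ⟨F, hF, hFe⟩ := mem_weakPolySubmodule.1 hg (AffineSubspace.mk' x (k ∙ v)) (by
    intro y hy
    obtain ⟨t, ht⟩ := Submodule.mem_span_singleton.1 ((AffineSubspace.mem_mk' ..).1 hy)
    have : y = x + t • v := by
      rw [ht, vsub_eq_sub]
      abel
    exact this ▸ h t)
  refine ⟨MvPolynomial.aeval (fun s => Polynomial.C (x s) + Polynomial.C (v s) * Polynomial.X) F,
    ?_, fun t => ?_⟩
  · refine (MvPolynomial.aeval_natDegree_le (n := 1) F hF _ fun i => ?_).trans (by simp)
    rw [add_comm]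
    exact Polynomial.natDegree_linear_le
  · rw [hFe]
    · rw [MvPolynomial.polynomial_eval_aeval]
      congr 2
      ext s
      simp only [Pi.add_apply, Pi.smul_apply, smul_eq_mul, Polynomial.eval_add, Polynomial.eval_mul,
        Polynomial.eval_C, Polynomial.eval_X, mul_comm t]
    · rw [SetLike.mem_coe, AffineSubspace.mem_mk', vsub_eq_sub, add_sub_cancel_left]
      exact Submodule.smul_mem _ _ (Submodule.mem_span_singleton_self v)

/-- Multiplication by `c` is linear, so it maps affine subspaces in `X` to affine subspaces in `X`.
This makes the weakly polynomial functions stable under the torus. -/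
theorem comp_linear_mem_weakPolySubmodule {k : Type u} [Field k] {σ : Type v} {a : ℕ}
    {X : Set (σ → k)} {g : (σ → k) → k} (hg : g ∈ weakPolySubmodule a X) (c : σ → k)
    (h : ∀ x ∈ X, c * x ∈ X) : (fun x => g (c * x)) ∈ weakPolySubmodule a X := by
  rw [mem_weakPolySubmodule]
  intro L hL
  let A : (σ → k) →ₗ[k] (σ → k) := LinearMap.mulLeft k c
  obtain ⟨F, hF, hFe⟩ := mem_weakPolySubmodule.1 hg (L.map A.toAffineMap) (by
    rintro _ ⟨x, hx, rfl⟩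
    exact h x (hL hx))
  refine ⟨MvPolynomial.aeval (fun s => MvPolynomial.C (c s) * MvPolynomial.X s) F, ?_, fun x hx => ?_⟩
  · refine (MvPolynomial.totalDegree_aeval_le F _ (D := 1) fun i => ?_).trans (by simpa using hF)
    refine (MvPolynomial.totalDegree_mul _ _).trans ?_
    simp
  · have := hFe (c * x) ⟨x, hx, rfl⟩
    rw [MvPolynomial.eval_aeval_eq]
    refine this.trans ?_
    congr 2
    ext s
    simp

/-! ### The torus action on `X_n`. -/

/-- The values of the products `x_i^1 ⋯ x_i^d` at `x`. -/
def blockProd {k : Type u} [Field k] {n d : ℕ} (x : Fin n × Fin d → k) (i : Fin n) : k :=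
  ∏ j, x (i, j)

/-- The points of `X_n`. -/
def blockHypersurface (k : Type u) [Field k] (n d : ℕ) : Set (Fin n × Fin d → k) :=
  {x | ∑ i, blockProd x i = 0}

/-- The torus element scaling by `t` the coordinate `J i` of each block `i`. -/
def torusVec {k : Type u} [Field k] {n d : ℕ} (J : Fin n → Fin d) (t : k) : Fin n × Fin d → k :=
  fun p => if p.2 = J p.1 then t else 1

/-- The point with coordinate `J i` of block `i` equal to `y i`, all other coordinates being `1`. -/
def sectionPoint {k : Type u} [Field k] {n d : ℕ} (J : Fin n → Fin d) (y : Fin n → k) :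
    Fin n × Fin d → k :=
  fun p => if p.2 = J p.1 then y p.1 else 1

theorem blockProd_torusVec_mul {k : Type u} [Field k] {n d : ℕ} (J : Fin n → Fin d) (t : k)
    (x : Fin n × Fin d → k) (i : Fin n) : blockProd (torusVec J t * x) i = t * blockProd x i := by
  simp only [blockProd, Pi.mul_apply, Finset.prod_mul_distrib]
  congr 1
  simp [torusVec]

theorem blockProd_sectionPoint {k : Type u} [Field k] {n d : ℕ} (J : Fin n → Fin d)
    (y : Fin n → k) : blockProd (sectionPoint J y) = y := by
  ext i
  simp [blockProd, sectionPoint]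

theorem sectionPoint_mem {k : Type u} [Field k] {n d : ℕ} (J : Fin n → Fin d)
    {y : Fin n → k} (hy : ∑ i, y i = 0) : sectionPoint J y ∈ blockHypersurface k n d := by
  change ∑ i, blockProd (sectionPoint J y) i = 0
  rw [blockProd_sectionPoint, hy]

theorem torusVec_mul_sectionPoint {k : Type u} [Field k] {n d : ℕ} (J : Fin n → Fin d)
    (t : k) (y : Fin n → k) : torusVec J t * sectionPoint J y = sectionPoint J (t • y) := by
  ext p
  by_cases h : p.2 = J p.1 <;> simp [torusVec, sectionPoint, h]

theorem torusVec_mul_mem {k : Type u} [Field k] {n d : ℕ} (J : Fin n → Fin d) (t : k)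
    {x : Fin n × Fin d → k} (hx : x ∈ blockHypersurface k n d) :
    torusVec J t * x ∈ blockHypersurface k n d := by
  change ∑ i, blockProd (torusVec J t * x) i = 0
  simp only [blockProd_torusVec_mul, ← Finset.mul_sum]
  rw [show ∑ i, blockProd x i = 0 from hx, mul_zero]

theorem torusVec_one {k : Type u} [Field k] {n d : ℕ} (J : Fin n → Fin d) :
    torusVec J (1 : k) = 1 := by
  ext p
  simp [torusVec]

theorem torusVec_mul_torusVec {k : Type u} [Field k] {n d : ℕ} (J : Fin n → Fin d) (s t : k) :
    torusVec J s * torusVec J t = torusVec J (s * t) := by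
  ext p
  by_cases h : p.2 = J p.1 <;> simp [torusVec, h]

theorem torusVec_pow {k : Type u} [Field k] {n d : ℕ} (J : Fin n → Fin d) (t : k) (m : ℕ) :
    torusVec J t ^ m = torusVec J (t ^ m) := by
  ext p
  by_cases h : p.2 = J p.1 <;> simp [torusVec, h]

/-- This relation is the source of the exchange property of the weights. -/
theorem torusVec_update_mul_torusVec_update {k : Type u} [Field k] {n d : ℕ}
    (J J' : Fin n → Fin d) (i : Fin n) (t : k) :
    torusVec (Function.update J i (J' i)) t * torusVec (Function.update J' i (J i)) t =
      torusVec J t * torusVec J' t := by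
  ext ⟨i', j⟩
  by_cases h : i' = i
  · subst h
    simp [torusVec, mul_comm]
  · simp [torusVec, h]

/-- Along the orbits of a one-parameter subgroup `torusVec J`, a weakly polynomial function is
polynomial. -/
theorem exists_polynomial_torusVec {k : Type u} [Field k] {n d a : ℕ}
    {g : (Fin n × Fin d → k) → k} (hg : g ∈ weakPolySubmodule a (blockHypersurface k n d))
    (J : Fin n → Fin d) {x : Fin n × Fin d → k} (hx : x ∈ blockHypersurface k n d) :
    ∃ q : Polynomial k, q.natDegree ≤ a ∧ ∀ t, g (torusVec J t * x) = q.eval t := by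
  -- Each coordinate is multiplied by `t` or by `1`, so the orbit is affine in `t`.
  have key : ∀ t : k, torusVec J t * x = torusVec J 0 * x + t • (x - torusVec J 0 * x) := by
    intro t
    ext p
    by_cases h : p.2 = J p.1 <;> simp [torusVec, h]
  obtain ⟨q, hq, hqe⟩ := exists_polynomial_of_line_subset hg (torusVec J 0 * x)
    (x - torusVec J 0 * x) fun t => by
      rw [← key]
      exact torusVec_mul_mem J t hx
  exact ⟨q, hq, fun t => by rw [key, hqe]⟩

/-- If `g` is an eigenfunction for `torusVec J β`, then it is homogeneous under the one-parameter
subgroup `torusVec J`. -/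
theorem exists_weight {k : Type u} [Field k] {n d a m : ℕ} {β : k} (hβ : IsPrimitiveRoot β m)
    (hm : 2 * a < m) {T : Finset k} (hT : a < T.card)
    {g : (Fin n × Fin d → k) → k} (hg : g ∈ weakPolySubmodule a (blockHypersurface k n d))
    {x : Fin n × Fin d → k} (hx : x ∈ blockHypersurface k n d) (hgx : g x ≠ 0)
    (J : Fin n → Fin d) {ζ : k} (hζ : ∀ y, g (torusVec J β * y) = ζ * g y) :
    ∃ e ≤ a, ∀ y ∈ blockHypersurface k n d, ∀ t, g (torusVec J t * y) = t ^ e * g y := by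
  -- Compare coefficients in `q(βt) = ζ q(t)`.
  have coeff_eq : ∀ y, ∀ q : Polynomial k, q.natDegree ≤ a →
      (∀ t, g (torusVec J t * y) = q.eval t) → ∀ s, q.coeff s ≠ 0 → β ^ s = ζ := by
    intro y q hq hqe s hs
    have : q.comp (Polynomial.C β * Polynomial.X) = Polynomial.C ζ * q := by
      refine Polynomial.eq_of_natDegree_le_of_eval_eq (N := a) ?_ ?_ hT fun t _ => ?_
      · rw [← pow_one (Polynomial.X : Polynomial k)]
        refine Polynomial.natDegree_comp_le.trans ?_
        exact (Nat.mul_le_mul hq (Polynomial.natDegree_C_mul_X_pow_le β 1)).trans (by simp)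
      · exact (Polynomial.natDegree_C_mul_le _ _).trans hq
      · simp only [Polynomial.eval_comp, Polynomial.eval_mul, Polynomial.eval_C,
          Polynomial.eval_X]
        rw [← hqe, ← hqe, ← hζ, ← mul_assoc, torusVec_mul_torusVec]
    have h2 := congrArg (Polynomial.coeff · s) this
    simp only [Polynomial.comp_C_mul_X_coeff, Polynomial.coeff_C_mul] at h2
    rw [mul_comm] at h2
    exact mul_right_cancel₀ hs h2
  obtain ⟨q, hq, hqe⟩ := exists_polynomial_torusVec hg J hx
  have hq0 : q ≠ 0 := by
    rintro rfl
    have := hqe 1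
    rw [torusVec_one, one_mul, Polynomial.eval_zero] at this
    exact hgx this
  have he := coeff_eq x q hq hqe q.natDegree (by simpa using hq0)
  refine ⟨q.natDegree, hq, fun y hy t => ?_⟩
  obtain ⟨r, hr, hre⟩ := exists_polynomial_torusVec hg J hy
  have hr' : r = Polynomial.C (r.coeff q.natDegree) * Polynomial.X ^ q.natDegree := by
    ext s
    rw [Polynomial.coeff_C_mul_X_pow]
    split_ifs with hs
    · rw [hs]
    · by_contra h
      have h1 := coeff_eq y r hr hre s h
      have h2 : s ≤ a := (Polynomial.le_natDegree_of_ne_zero h).trans hr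
      -- Exponents at most `a < m` are determined by the value of `β ^ s`.
      exact hs (hβ.pow_inj (by omega) (by omega) (h1.trans he.symm))
  have h1 := hre 1
  rw [torusVec_one, one_mul, hr'] at h1
  rw [hre, hr', h1]
  simp only [Polynomial.eval_mul, Polynomial.eval_C, Polynomial.eval_pow, Polynomial.eval_X,
    one_pow, mul_one]
  ring

/-! ### Propagation of zeros over `X_n`. -/

/-- The product of the coordinates of the block of `p` other than `p`. -/
def coordCofactor {k : Type u} [Field k] {n d : ℕ} (x : Fin n × Fin d → k) (p : Fin n × Fin d) :
    k :=
  ∏ j ∈ Finset.univ.erase p.2, x (p.1, j)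

theorem blockProd_add_single {k : Type u} [Field k] {n d : ℕ} (x : Fin n × Fin d → k)
    (p : Fin n × Fin d) (s : k) :
    blockProd (x + Pi.single p s) = blockProd x + Pi.single p.1 (s * coordCofactor x p) := by
  obtain ⟨i, j⟩ := p
  ext i'
  by_cases h : i' = i
  · subst h
    simp only [blockProd, coordCofactor, Pi.add_apply, Pi.single_eq_same]
    rw [← Finset.mul_prod_erase _ _ (Finset.mem_univ j), ← Finset.mul_prod_erase _ (fun j => x (i', j))
      (Finset.mem_univ j), Pi.single_eq_same, add_mul]
    have : ∀ j' ∈ Finset.univ.erase j,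
        x (i', j') + (Pi.single (i', j) s : Fin n × Fin d → k) (i', j') = x (i', j') := by
      intro j' hj'
      rw [Pi.single_eq_of_ne, add_zero]
      exact fun h => Finset.ne_of_mem_erase hj' (Prod.ext_iff.1 h).2
    rw [Finset.prod_congr rfl this]
  · simp only [blockProd, Pi.add_apply, Pi.single_eq_of_ne h, add_zero]
    refine Finset.prod_congr rfl fun j' _ => ?_
    rw [Pi.single_eq_of_ne, add_zero]
    exact fun h' => h (Prod.ext_iff.1 h').1

/-- A weakly polynomial function vanishing on a line outside at most two points vanishes on it. -/
theorem eq_zero_of_line {k : Type u} [Field k] {σ : Type v} {a : ℕ} {X : Set (σ → k)}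
    {g : (σ → k) → k} (hg : g ∈ weakPolySubmodule a X) {T : Finset k} (hT : a + 2 < T.card)
    (x v : σ → k) (h : ∀ t : k, x + t • v ∈ X) (b : k)
    (h0 : ∀ t : k, t ≠ 0 → t ≠ b → g (x + t • v) = 0) : g x = 0 := by
  classical
  obtain ⟨q, hq, hqe⟩ := exists_polynomial_of_line_subset hg x v h
  have : q = 0 := by
    refine Polynomial.eq_of_natDegree_le_of_eval_eq (N := a) (T := (T.erase 0).erase b) hq (by simp)
      ?_ fun t ht => ?_
    · have h1 := Finset.pred_card_le_card_erase (s := T) (a := (0 : k))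
      have h2 := Finset.pred_card_le_card_erase (s := T.erase 0) (a := b)
      omega
    · rw [← hqe, h0 t (Finset.ne_of_mem_erase (Finset.mem_of_mem_erase ht))
        (Finset.ne_of_mem_erase ht), Polynomial.eval_zero]
  simpa [this] using hqe 0

/-- Torus moves normalize the coordinates off `J₀` to `1` one at a time, by induction on how many
differ from `1`. -/
theorem eq_zero_of_vanish_on_section_of_ne_zero {k : Type u} [Field k] {n d : ℕ}
    {g : (Fin n × Fin d → k) → k} (J₀ : Fin n → Fin d)
    (hscale : ∀ J : Fin n → Fin d, ∀ t : k, t ≠ 0 → ∀ x ∈ blockHypersurface k n d,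
      g (torusVec J t * x) = 0 → g x = 0)
    (h0 : ∀ y : Fin n → k, ∑ i, y i = 0 → g (sectionPoint J₀ y) = 0)
    (x : Fin n × Fin d → k) (hx : x ∈ blockHypersurface k n d) (hne : ∀ p, x p ≠ 0) : g x = 0 := by
  classical
  induction hN : (Finset.univ.filter fun p : Fin n × Fin d => p.2 ≠ J₀ p.1 ∧ x p ≠ 1).card
    using Nat.strong_induction_on generalizing x with
  | _ N ih =>
  by_cases hex : ∃ p : Fin n × Fin d, p.2 ≠ J₀ p.1 ∧ x p ≠ 1
  · obtain ⟨p, hp, hxp⟩ := hex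
    have hmem := torusVec_mul_mem J₀ (x p) hx
    -- The two scalings cancel outside block `p.1`; there they turn coordinate `p` into `1` and
    -- multiply the `J₀` coordinate by `x p`.
    refine hscale J₀ (x p) (hne p) x hx (hscale (Function.update J₀ p.1 p.2) (x p)⁻¹
      (inv_ne_zero (hne p)) _ hmem ?_)
    refine ih _ ?_ _ (torusVec_mul_mem _ _ hmem) (fun q => ?_) rfl
    · rw [← hN]
      refine Finset.card_lt_card ⟨fun q hq => ?_, fun hsub => ?_⟩
      · simp only [Finset.mem_filter, Finset.mem_univ, true_and] at hq ⊢
        refine ⟨hq.1, fun hq1 => hq.2 ?_⟩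
        have hqp : q.1 ≠ p.1 ∨ q.2 ≠ p.2 := by
          by_contra! hc
          exact hxp (Prod.ext hc.1 hc.2 ▸ hq1)
        by_cases h1 : q.1 = p.1
        · simp [torusVec, h1, hq1, hqp.resolve_left (not_not.2 h1)]
          intro h2
          exact absurd (h1 ▸ h2) hq.1
        · simp [torusVec, hq.1, Function.update_of_ne h1, hq1]
      · have := hsub (Finset.mem_filter.2 ⟨Finset.mem_univ p, hp, hxp⟩)
        simp [torusVec, hp, hne p] at this
    · simp only [torusVec, Pi.mul_apply]
      refine mul_ne_zero ?_ (mul_ne_zero ?_ (hne q)) <;> split_ifs <;> simp [hne p]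
  · push Not at hex
    have : x = sectionPoint J₀ fun i => x (i, J₀ i) := by
      ext p
      by_cases h : p.2 = J₀ p.1
      · simp only [sectionPoint, ← h, if_true]
      · simp [sectionPoint, h, hex p h]
    rw [this]
    refine h0 _ ?_
    have hx' : ∑ i, blockProd x i = 0 := hx
    rw [this, blockProd_sectionPoint] at hx'
    exact hx'

/-- A weakly polynomial function on `X_n`, `n ≥ 2`, is determined by its values at the points with
nonzero coordinates. -/
theorem eq_zero_of_vanish_of_ne_zero {k : Type u} [Field k] {n d a : ℕ} (hn : 2 ≤ n)
    {g : (Fin n × Fin d → k) → k} (hg : g ∈ weakPolySubmodule a (blockHypersurface k n d))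
    {T : Finset k} (hT : a + 2 < T.card)
    (h0 : ∀ x ∈ blockHypersurface k n d, (∀ p, x p ≠ 0) → g x = 0)
    (x : Fin n × Fin d → k) (hx : x ∈ blockHypersurface k n d) : g x = 0 := by
  classical
  induction hN : (Finset.univ.filter fun p : Fin n × Fin d => x p = 0).card
    using Nat.strong_induction_on generalizing x with
  | _ N ih =>
  have hx' : ∑ i, blockProd x i = 0 := hx
  -- It suffices to find a line along which the zero coordinate `p` moves
  have step : ∀ (p : Fin n × Fin d) (v : Fin n × Fin d → k) (b : k), x p = 0 → v p ≠ 0 →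
      (∀ t : k, x + t • v ∈ blockHypersurface k n d) →
      (∀ t : k, t ≠ 0 → t ≠ b → ∀ q, x q ≠ 0 → (x + t • v) q ≠ 0) → g x = 0 := by
    intro p v b hp hv hl hq
    refine eq_zero_of_line hg hT x v hl b fun t ht htb => ih _ ?_ _ (hl t) rfl
    rw [← hN]
    refine Finset.card_lt_card ⟨fun q hq0 => ?_, fun hsub => ?_⟩
    · simp only [Finset.mem_filter, Finset.mem_univ, true_and] at hq0 ⊢
      by_contra h
      exact hq t ht htb q h hq0
    · have := hsub (Finset.mem_filter.2 ⟨Finset.mem_univ p, hp⟩)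
      simp [hp, ht, hv] at this
  by_cases hz : ∀ p, x p ≠ 0
  · exact h0 x hx hz
  push Not at hz
  obtain ⟨p, hp⟩ := hz
  -- If the block has another zero, moving `p` alone does not change the block product.
  by_cases hc : coordCofactor x p = 0
  · refine step p (Pi.single p 1) 0 hp (by simp) (fun t => ?_) fun t ht _ q hq => ?_
    · change ∑ i, blockProd (x + t • Pi.single p 1) i = 0
      rw [← Pi.single_smul, blockProd_add_single, hc, mul_zero, Pi.single_zero, add_zero, hx']
    · have : q ≠ p := fun h => hq (h ▸ hp)
      simpa [this] using hq
  by_cases hall : ∃ p', x p' = 0 ∧ coordCofactor x p' = 0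
  · obtain ⟨p', hp', hc'⟩ := hall
    refine step p' (Pi.single p' 1) 0 hp' (by simp) (fun t => ?_) fun t ht _ q hq => ?_
    · change ∑ i, blockProd (x + t • Pi.single p' 1) i = 0
      rw [← Pi.single_smul, blockProd_add_single, hc', mul_zero, Pi.single_zero, add_zero, hx']
    · have : q ≠ p' := fun h => hq (h ▸ hp')
      simpa [this] using hq
  push Not at hall
  obtain ⟨i', hi'⟩ : ∃ i' : Fin n, i' ≠ p.1 := by
    have : Nontrivial (Fin n) := Fin.nontrivial_iff_two_le.2 hn
    exact exists_ne p.1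
  obtain ⟨j', hj'⟩ : ∃ j' : Fin d, coordCofactor x (i', j') ≠ 0 := by
    by_cases h : ∃ j', x (i', j') = 0
    · obtain ⟨j', h⟩ := h
      exact ⟨j', hall _ h⟩
    · push Not at h
      exact ⟨p.2, Finset.prod_ne_zero_iff.2 fun j _ => h j⟩
  set z := coordCofactor x p
  set z' := coordCofactor x (i', j')
  have hpp : p ≠ (i', j') := fun h => hi' (by rw [h])
  -- A coordinate of another block compensates the change in the block of `p`. It vanishes only at
  -- the excluded parameter `x (i', j') * z' / z`.
  refine step p (Pi.single p 1 + Pi.single (i', j') (-(z / z'))) (x (i', j') * z' / z) hp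
    (by simp [hpp]) (fun t => ?_) fun t ht htb q hq => ?_
  · change ∑ i, blockProd (x + t • (Pi.single p 1 + Pi.single (i', j') (-(z / z')))) i = 0
    have hcof : coordCofactor (x + Pi.single p t) (i', j') = z' := by
      refine Finset.prod_congr rfl fun j _ => ?_
      have : (i', j) ≠ p := fun h => hi' (by rw [← h])
      simp [this]
    rw [smul_add, ← Pi.single_smul, ← Pi.single_smul, ← add_assoc, smul_eq_mul, smul_eq_mul, mul_one,
      blockProd_add_single, hcof, blockProd_add_single]
    simp only [Pi.add_apply, Finset.sum_add_distrib, hx', Finset.sum_pi_single', Finset.mem_univ,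
      if_true]
    field_simp
    ring
  · have hqp : q ≠ p := fun h => hq (h ▸ hp)
    by_cases hq' : q = (i', j')
    · subst hq'
      simp only [Pi.add_apply, Pi.smul_apply, Pi.single_eq_of_ne hqp, Pi.single_eq_same, zero_add,
        smul_eq_mul]
      intro h
      apply htb
      field_simp at h ⊢
      linear_combination -h
    · simpa [hqp, hq'] using hq

/-! ### The structure and size of the weights. -/

/-- A function of tuples that is additive under exchange of entries is its minimum plus a sum of
nonnegative functions of the entries. -/
theorem exists_eq_add_sum_of_exchange {n d : ℕ} (hd : 1 ≤ d) (e : (Fin n → Fin d) → ℕ)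
    (he : ∀ J J' i, e (Function.update J i (J' i)) + e (Function.update J' i (J i)) = e J + e J') :
    ∃ (J₀ : Fin n → Fin d) (w : Fin n → Fin d → ℕ), (∀ i, w i (J₀ i) = 0) ∧
      ∀ J, e J = e J₀ + ∑ i, w i (J i) := by
  classical
  have : Nonempty (Fin d) := ⟨⟨0, hd⟩⟩
  obtain ⟨J₀, hJ₀⟩ := Finite.exists_min e
  let w : Fin n → Fin d → ℕ := fun i j => e (Function.update J₀ i j) - e J₀
  have hw : ∀ i j, e (Function.update J₀ i j) = e J₀ + w i j := fun i j => by
    have := hJ₀ (Function.update J₀ i j)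
    simp only [w]
    omega
  refine ⟨J₀, w, fun i => by simp [w], fun J => ?_⟩
  suffices H : ∀ S : Finset (Fin n),
      e (fun i => if i ∈ S then J i else J₀ i) = e J₀ + ∑ i ∈ S, w i (J i) by
    simpa using H Finset.univ
  intro S
  induction S using Finset.induction_on with
  | empty => simp
  | insert i S hi ih =>
    -- Exchanging entry `i` with `J₀` separates the contribution of `J i`.
    have h1 := he (fun i' => if i' ∈ insert i S then J i' else J₀ i') J₀ i
    have h2 : Function.update (fun i' => if i' ∈ insert i S then J i' else J₀ i') i (J₀ i) =
        fun i' => if i' ∈ S then J i' else J₀ i' := by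
      ext i'
      by_cases h : i' = i
      · subst h
        simp [hi]
      · simp [h]
    rw [h2, ih, if_pos (Finset.mem_insert_self _ _), hw] at h1
    rw [Finset.sum_insert hi]
    omega

/-- The total weight of a homogeneous weakly polynomial function of degree `≤ a` is at most `a`. -/
theorem sum_weight_le {k : Type u} [Field k] {n d a : ℕ} (hd : 1 ≤ d) {T : Finset k}
    (hT : a * d < T.card) {g : (Fin n × Fin d → k) → k}
    (hg : g ∈ weakPolySubmodule a (blockHypersurface k n d))
    {x : Fin n × Fin d → k} (hx : x ∈ blockHypersurface k n d) (hgx : g x ≠ 0)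
    {e : (Fin n → Fin d) → ℕ} (he : ∀ J, e J ≤ a)
    (hge : ∀ J, ∀ y ∈ blockHypersurface k n d, ∀ t, g (torusVec J t * y) = t ^ e J * g y) :
    ∑ j, e (fun _ => j) ≤ a := by
  classical
  -- Scaling the columns `j ∈ S` one after another; for all of them this is dilation by `t`.
  have key : ∀ (t : k) (S : Finset (Fin d)),
      (fun p : Fin n × Fin d => if p.2 ∈ S then t * x p else x p) ∈ blockHypersurface k n d ∧
      g (fun p => if p.2 ∈ S then t * x p else x p) = t ^ (∑ j ∈ S, e fun _ => j) * g x := by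
    intro t S
    induction S using Finset.induction_on with
    | empty => simpa using hx
    | insert j S hj ih =>
      have h1 : (fun p : Fin n × Fin d => if p.2 ∈ insert j S then t * x p else x p) =
          torusVec (fun _ => j) t * fun p => if p.2 ∈ S then t * x p else x p := by
        ext p
        by_cases h : p.2 = j
        · simp [torusVec, h, hj]
        · simp [torusVec, h]
      rw [h1, hge _ _ ih.1, ih.2, Finset.sum_insert hj, pow_add, mul_assoc]
      exact ⟨torusVec_mul_mem _ _ ih.1, rfl⟩
  have key' : ∀ t : k, 0 + t • x ∈ blockHypersurface k n d ∧
      g (0 + t • x) = t ^ (∑ j, e fun _ => j) * g x := by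
    intro t
    have : 0 + t • x = fun p : Fin n × Fin d => if p.2 ∈ Finset.univ then t * x p else x p := by
      ext p
      simp
    rw [this]
    exact key t Finset.univ
  obtain ⟨q, hq, hqe⟩ := exists_polynomial_of_line_subset hg 0 x fun t => (key' t).1
  -- The a priori bound `a * d`, below the size of `T'`, lets values identify `q` with the monomial,
  -- whose degree is then at most `a`.
  have hN : ∑ j, e (fun _ : Fin n => j) ≤ a * d := by
    refine (Finset.sum_le_sum fun j _ => he _).trans ?_
    simp [mul_comm]
  have hqq : q = Polynomial.C (g x) * Polynomial.X ^ (∑ j, e fun _ : Fin n => j) := by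
    refine Polynomial.eq_of_natDegree_le_of_eval_eq (N := a * d)
      (hq.trans (Nat.le_mul_of_pos_right a hd))
      ((Polynomial.natDegree_C_mul_X_pow_le _ _).trans hN) hT fun t _ => ?_
    rw [← hqe, (key' t).2]
    simp only [Polynomial.eval_mul, Polynomial.eval_C, Polynomial.eval_pow, Polynomial.eval_X]
    ring
  rwa [hqq, Polynomial.natDegree_C_mul_X_pow _ _ hgx] at hq

/-! ### Extension of torus-homogeneous functions. -/

open MvPolynomial in
theorem MvPolynomial.eval_smul_homogeneousComponent {k : Type u} [Field k] {σ : Type*} (b : ℕ)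
    (P : MvPolynomial σ k) (t : k) (y : σ → k) :
    eval (t • y) (homogeneousComponent b P) = t ^ b * eval y (homogeneousComponent b P) := by
  rw [eval_eq, eval_eq, Finset.mul_sum]
  refine Finset.sum_congr rfl fun m hm => ?_
  have hdeg : ∑ i ∈ m.support, m i = b := by
    have := homogeneousComponent_isHomogeneous b P (mem_support_iff.1 hm)
    rwa [Pi.one_def, ← Finsupp.degree_eq_weight_one] at this
  simp only [Pi.smul_apply, smul_eq_mul, mul_pow, Finset.prod_mul_distrib,
    Finset.prod_pow_eq_pow_sum, hdeg]
  ring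

open MvPolynomial in
/-- A polynomial function on a set stable under scaling which is homogeneous of degree `b` there
is given there by the homogeneous component of degree `b`. -/
theorem eval_homogeneousComponent_eq {k : Type u} [Field k] {σ : Type*} {a b : ℕ}
    {T : Finset k} (hT : a < T.card) (hb : b ≤ a) {P : MvPolynomial σ k} (hP : P.totalDegree ≤ a)
    {y : σ → k} {c : k} (h : ∀ t : k, eval (t • y) P = t ^ b * c) :
    eval y (homogeneousComponent b P) = c := by
  let q : Polynomial k := ∑ s ∈ Finset.range (P.totalDegree + 1),
    Polynomial.C (eval y (homogeneousComponent s P)) * Polynomial.X ^ s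
  have hq : q = Polynomial.C c * Polynomial.X ^ b := by
    refine Polynomial.eq_of_natDegree_le_of_eval_eq (N := a) ?_
      ((Polynomial.natDegree_C_mul_X_pow_le _ _).trans hb) hT fun t _ => ?_
    · refine Polynomial.natDegree_sum_le_of_forall_le _ _ fun s hs => ?_
      have := Finset.mem_range.1 hs
      exact (Polynomial.natDegree_C_mul_X_pow_le _ _).trans (by omega)
    · have := h t
      rw [← sum_homogeneousComponent P, map_sum] at this
      simp only [eval_smul_homogeneousComponent] at this
      simp only [q, Polynomial.eval_finsetSum, Polynomial.eval_mul, Polynomial.eval_C,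
        Polynomial.eval_pow, Polynomial.eval_X]
      rw [mul_comm c, ← this]
      exact Finset.sum_congr rfl fun s _ => mul_comm _ _
  have h2 := congrArg (Polynomial.coeff · b) hq
  simp only [q, Polynomial.finsetSum_coeff, Polynomial.coeff_C_mul_X_pow, Finset.sum_ite_eq,
    if_true] at h2
  rw [← h2]
  split_ifs with hbr
  · rfl
  · rw [homogeneousComponent_eq_zero _ _ (by simpa using hbr), map_zero]

/-- The affine subspace of the points `sectionPoint J y` with `∑ y i = 0`. -/
def sectionSubspace (k : Type u) [Field k] {n d : ℕ} (J : Fin n → Fin d) :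
    AffineSubspace k (Fin n × Fin d → k) where
  carrier := {x | (∀ p, p.2 ≠ J p.1 → x p = 1) ∧ ∑ i, x (i, J i) = 0}
  smul_vsub_vadd_mem' := by
    rintro c p₁ p₂ p₃ ⟨h1, h1'⟩ ⟨h2, h2'⟩ ⟨h3, h3'⟩
    refine ⟨fun p hp => ?_, ?_⟩
    · simp [h1 p hp, h2 p hp, h3 p hp]
    · simp [Finset.sum_add_distrib, ← Finset.mul_sum, h1', h2', h3']

theorem sectionSubspace_subset (k : Type u) [Field k] {n d : ℕ} (J : Fin n → Fin d) :
    (sectionSubspace k J : Set (Fin n × Fin d → k)) ⊆ blockHypersurface k n d := by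
  rintro x ⟨h, h'⟩
  have : x = sectionPoint J fun i => x (i, J i) := by
    ext p
    by_cases hp : p.2 = J p.1
    · simp only [sectionPoint, ← hp, if_true]
    · simp [sectionPoint, hp, h p hp]
  rw [this]
  exact sectionPoint_mem J h'

theorem sectionPoint_mem_sectionSubspace {k : Type u} [Field k] {n d : ℕ} (J : Fin n → Fin d)
    {y : Fin n → k} (hy : ∑ i, y i = 0) : sectionPoint J y ∈ sectionSubspace k J :=
  ⟨fun p hp => by simp [sectionPoint, hp], by simpa [sectionPoint] using hy⟩

open MvPolynomial in
/-- A weakly polynomial function of degree `≤ a` which is homogeneous under the torus is the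
restriction of a polynomial of degree `≤ a`. -/
theorem mem_polySubmodule_of_homogeneous {k : Type u} [Field k] {n d a : ℕ} (hn : 2 ≤ n)
    (hd : 1 ≤ d) {T T' : Finset k} (hT : a + 2 < T.card) (hT' : a * d < T'.card)
    {g : (Fin n × Fin d → k) → k}
    (hg : g ∈ weakPolySubmodule a (blockHypersurface k n d))
    {x : Fin n × Fin d → k} (hx : x ∈ blockHypersurface k n d) (hgx : g x ≠ 0)
    {e : (Fin n → Fin d) → ℕ} (he : ∀ J, e J ≤ a)
    (hex : ∀ J J' i,
      e (Function.update J i (J' i)) + e (Function.update J' i (J i)) = e J + e J')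
    (hge : ∀ J, ∀ y ∈ blockHypersurface k n d, ∀ t, g (torusVec J t * y) = t ^ e J * g y) :
    g ∈ polySubmodule a (blockHypersurface k n d) := by
  classical
  have hsum := sum_weight_le hd hT' hg hx hgx he hge
  obtain ⟨J₀, w, hw0, hw⟩ := exists_eq_add_sum_of_exchange hd e hex
  obtain ⟨G, hG, hGe⟩ := mem_weakPolySubmodule.1 hg _ (sectionSubspace_subset k J₀)
  let P : MvPolynomial (Fin n) k := aeval (fun p => if p.2 = J₀ p.1 then X p.1 else 1) G
  have hP : P.totalDegree ≤ a := by
    refine (totalDegree_aeval_le G _ (D := 1) fun p => ?_).trans (by simpa using hG)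
    split_ifs <;> simp
  have hPe : ∀ y : Fin n → k, ∑ i, y i = 0 → eval y P = g (sectionPoint J₀ y) := by
    intro y hy
    rw [hGe _ (sectionPoint_mem_sectionSubspace J₀ hy), eval_aeval_eq]
    congr 2
    ext p
    simp only [sectionPoint]
    split_ifs <;> simp
  have hPb : ∀ y : Fin n → k, ∑ i, y i = 0 →
      eval y (homogeneousComponent (e J₀) P) = g (sectionPoint J₀ y) := by
    intro y hy
    refine eval_homogeneousComponent_eq (T := T) (by omega) (he J₀) hP fun t => ?_
    rw [hPe _ (by simp [← Finset.mul_sum, hy]), ← torusVec_mul_sectionPoint,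
      hge J₀ _ (sectionPoint_mem J₀ hy)]
  -- The block products carry the weight `e J₀` common to all `J`, the monomial the excess `∑ w i (J
  -- i)`; the monomial equals `1` on the section since `w i (J₀ i) = 0`.
  let F : MvPolynomial (Fin n × Fin d) k := (∏ p, X p ^ w p.1 p.2) *
    aeval (fun i => ∏ j, X (i, j)) (homogeneousComponent (e J₀) P)
  have hF : F.totalDegree ≤ a := by
    refine (totalDegree_mul _ _).trans ((add_le_add ?_ ?_).trans (?_ :
      (∑ p : Fin n × Fin d, w p.1 p.2) + e J₀ * d ≤ a))
    · refine (totalDegree_finsetProd _ _).trans (Finset.sum_le_sum fun p _ => ?_)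
      simp
    · refine (totalDegree_aeval_le _ _ (D := d) fun i => ?_).trans
        (Nat.mul_le_mul_right _ (homogeneousComponent_isHomogeneous _ _).totalDegree_le)
      refine (totalDegree_finsetProd _ _).trans ?_
      simp
    -- The degree bound for `F` is exactly `∑_j e (j, …, j)`.
    · rw [Finset.sum_congr rfl fun j _ => hw fun _ => j] at hsum
      simp only [Finset.sum_add_distrib, Finset.sum_const, Finset.card_univ,
        Fintype.card_fin, smul_eq_mul] at hsum
      rw [Fintype.sum_prod_type, Finset.sum_comm]
      linarith
  have hFe : ∀ y, eval y F = (∏ p, y p ^ w p.1 p.2) *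
      eval (blockProd y) (homogeneousComponent (e J₀) P) := by
    intro y
    simp only [F, map_mul, map_prod, map_pow, eval_X, eval_aeval_eq]
    rfl
  have hFt : ∀ J (t : k) y, eval (torusVec J t * y) F = t ^ e J * eval y F := by
    intro J t y
    have h1 : blockProd (torusVec J t * y) = t • blockProd y := by
      ext i
      simp [blockProd_torusVec_mul]
    have h2 : ∏ p : Fin n × Fin d, torusVec J t p ^ w p.1 p.2 = t ^ ∑ i, w i (J i) := by
      rw [Fintype.prod_prod_type, ← Finset.prod_pow_eq_pow_sum]
      refine Finset.prod_congr rfl fun i _ => ?_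
      rw [Finset.prod_eq_single (J i)] <;> simp +contextual [torusVec]
    rw [hFe, hFe, h1, eval_smul_homogeneousComponent, hw J, pow_add]
    simp only [Pi.mul_apply, mul_pow, Finset.prod_mul_distrib, h2]
    ring
  have hFp : (fun y => eval y F) ∈ polySubmodule a (blockHypersurface k n d) :=
    ⟨F, hF, fun _ _ => rfl⟩
  have hDw := Submodule.sub_mem _ hg (polySubmodule_le_weakPolySubmodule _ _ hFp)
  refine ⟨F, hF, fun y hy => sub_eq_zero.1 (eq_zero_of_vanish_of_ne_zero hn hDw hT
    (eq_zero_of_vanish_on_section_of_ne_zero J₀ ?_ ?_) y hy)⟩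
  · intro J t ht z hz h
    simp only [Pi.sub_apply] at h ⊢
    rw [hge J z hz, hFt, ← mul_sub] at h
    exact (mul_eq_zero.1 h).resolve_left (pow_ne_zero _ ht)
  · intro z hz
    simp only [Pi.sub_apply]
    rw [hFe, blockProd_sectionPoint, hPb z hz, Finset.prod_eq_one, one_mul, sub_self]
    intro p _
    by_cases h : p.2 = J₀ p.1
    · simp [h, hw0]
    · simp [sectionPoint, h]

/-- Diagonalization reduces to common eigenfunctions of the operators `U J`, to which
`exists_weight` assigns weights. -/
theorem weakPolySubmodule_le_of_two_le {k : Type u} [Field k] {n d a m : ℕ} (ha : 1 ≤ a)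
    (hn : 2 ≤ n) (hd : 1 ≤ d) {β : k} (hβ : IsPrimitiveRoot β m) (hm : 2 * a < m)
    (hcard : ((a * d : ℕ) : ℕ∞) < ENat.card k) :
    weakPolySubmodule a (blockHypersurface k n d) ≤ polySubmodule a (blockHypersurface k n d) := by
  classical
  -- `T` has at least `2a + 2` elements, which exceeds `a + 2` because `a ≥ 1`.
  obtain ⟨T, hT⟩ := hβ.exists_finset_lt_card (by omega)
  obtain ⟨T', hT'⟩ := exists_finset_lt_card hcard
  let U : (Fin n → Fin d) → Module.End k ((Fin n × Fin d → k) → k) :=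
    fun J => LinearMap.funLeft k k fun x => torusVec J β * x
  have hUp : ∀ J q g, (U J ^ q) g = fun x => g (torusVec J β ^ q * x) := by
    intro J q g
    induction q with
    | zero => simp
    | succ q ih =>
      rw [pow_succ', Module.End.mul_apply, ih]
      ext x
      simp [U, LinearMap.funLeft_apply, pow_succ, mul_assoc]
  refine le_of_forall_commonEigenvector_mem hβ (by omega) U (fun J J' => ?_) (fun J => ?_) _ _
    (fun J g hg => comp_linear_mem_weakPolySubmodule hg _ fun x hx => torusVec_mul_mem J β hx)
    fun g hg hU => ?_
  · refine LinearMap.ext fun g => ?_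
    ext x
    simp [U, LinearMap.funLeft_apply, mul_left_comm]
  · refine LinearMap.ext fun g => ?_
    rw [hUp, torusVec_pow, hβ.pow_eq_one, torusVec_one]
    simp
  · by_cases hg0 : ∀ x ∈ blockHypersurface k n d, g x = 0
    · exact ⟨0, by simp, by simpa using hg0⟩
    push Not at hg0
    obtain ⟨x, hx, hgx⟩ := hg0
    choose ζ hζ using hU
    choose e he hge using fun J => exists_weight hβ hm (T := T) (by omega) hg hx hgx J
      (ζ := ζ J) fun y => congrFun (hζ J) y
    refine mem_polySubmodule_of_homogeneous hn hd (T := T) (by omega) hT' hg hx hgx he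
      (fun J J' i => ?_) hge
    have h1 := congrArg (fun v => g (v * x)) (torusVec_update_mul_torusVec_update J J' i β)
    simp only [mul_assoc] at h1
    rw [hge _ _ (torusVec_mul_mem _ _ hx), hge _ _ hx, hge _ _ (torusVec_mul_mem _ _ hx),
      hge _ _ hx, ← mul_assoc, ← mul_assoc, ← pow_add, ← pow_add] at h1
    have h2 := he J
    have h3 := he J'
    have h4 := he (Function.update J i (J' i))
    have h5 := he (Function.update J' i (J i))
    -- Both sums of two weights are at most `2a < m`, so equality of powers of `β` gives equality of
    -- exponents.
    exact hβ.pow_inj (by omega) (by omega) (mul_right_cancel₀ hgx h1)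

/-! ### The cases `n ≤ 1` and the conclusion. -/

/-- A function on a union of coordinate hyperplanes that is polynomial of degree `≤ a` on each of
them is polynomial of degree `≤ a`. -/
theorem exists_polynomial_of_coordinate_hyperplanes {k : Type u} [Field k] {σ : Type v} {a : ℕ}
    {g : (σ → k) → k} (S : Finset σ) (h : ∀ s ∈ S, g ∈ polySubmodule a {x | x s = 0}) :
    g ∈ polySubmodule a {x | ∃ s ∈ S, x s = 0} := by
  classical
  induction S using Finset.induction_on with
  | empty => exact ⟨0, by simp, by simp⟩
  | insert s S hs ih =>
    obtain ⟨F, hF, hFe⟩ := ih fun s' hs' => h s' (Finset.mem_insert_of_mem hs')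
    obtain ⟨G, hG, hGe⟩ := h s (Finset.mem_insert_self _ _)
    have hH : (MvPolynomial.aeval (fun s' => if s' = s then 0 else MvPolynomial.X s')
        (G - F) : MvPolynomial σ k).totalDegree ≤ a := by
      refine (MvPolynomial.totalDegree_aeval_le _ _ (D := 1) fun s' => ?_).trans ?_
      · split_ifs <;> simp
      · rw [mul_one]
        exact (MvPolynomial.totalDegree_sub _ _).trans (max_le hG hF)
    -- The correction, `G - F` with `x_s` set to `0`, repairs the value on `x_s = 0`. It vanishes on
    -- the earlier hyperplanes, since setting `x_s = 0` stays inside them and there `F` and `G` both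
    -- equal `g`.
    refine ⟨F + MvPolynomial.aeval (fun s' => if s' = s then 0 else MvPolynomial.X s') (G - F),
      (MvPolynomial.totalDegree_add _ _).trans (max_le hF hH), ?_⟩
    rintro x ⟨s', hs', hxs'⟩
    have hx : (fun i => MvPolynomial.eval x (if i = s then 0 else MvPolynomial.X i)) =
        Function.update x s 0 := by
      ext i
      by_cases hi : i = s
      · subst hi
        simp
      · simp [hi]
    rw [map_add, MvPolynomial.eval_aeval_eq, hx, map_sub]
    rcases Finset.mem_insert.1 hs' with rfl | hs'S
    · rw [← hxs', Function.update_eq_self, ← hGe x hxs']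
      ring
    · rw [← hGe (Function.update x s 0) (by simp), ← hFe x ⟨s', hs'S, hxs'⟩,
        ← hFe (Function.update x s 0) ⟨s', hs'S, ?_⟩]
      · ring
      · by_cases hss : s' = s
        · simp [hss]
        · simpa [hss] using hxs'

/-- `X_1` is the union of the coordinate hyperplanes, each an affine subspace inside it. -/
theorem weakPolySubmodule_le_of_eq_one {k : Type u} [Field k] {d a : ℕ} :
    weakPolySubmodule a (blockHypersurface k 1 d) ≤ polySubmodule a (blockHypersurface k 1 d) := by
  have hX : ∀ x, x ∈ blockHypersurface k 1 d ↔
      ∃ s ∈ (Finset.univ : Finset (Fin 1 × Fin d)), x s = 0 := by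
    intro x
    simp [blockHypersurface, blockProd, Finset.prod_eq_zero_iff]
  intro g hg
  obtain ⟨F, hF, hFe⟩ := exists_polynomial_of_coordinate_hyperplanes (a := a) (g := g) Finset.univ
    fun s _ => mem_weakPolySubmodule.1 hg
      (LinearMap.ker (LinearMap.proj (R := k) (φ := fun _ => k) s)).toAffineSubspace
      fun x hx => (hX x).2 ⟨s, Finset.mem_univ s, hx⟩
  exact ⟨F, hF, fun x hx => hFe x ((hX x).1 hx)⟩

theorem weakPolySubmodule_le_of_eq_zero {k : Type u} [Field k] {d a : ℕ} :
    weakPolySubmodule a (blockHypersurface k 0 d) ≤ polySubmodule a (blockHypersurface k 0 d) := by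
  intro g hg
  obtain ⟨F, hF, hFe⟩ := mem_weakPolySubmodule.1 hg ⊤ fun x _ => by simp [blockHypersurface]
  exact ⟨F, hF, fun x _ => hFe x (Set.mem_univ x)⟩

theorem hypersurfacePoints_polyP (k l : Type u) [Field k] [Field l] [Algebra k l] (n d : ℕ) :
    hypersurfacePoints (polyP k n d) l = blockHypersurface l n d := by
  ext x
  simp [hypersurfacePoints, blockHypersurface, polyP, blockProd]

theorem satisfiesStar_polyP {n d a : ℕ} (hd : 1 ≤ d) (ha : 1 ≤ a) (k : Type u) [Field k]
    (hk : IsAdmissibleField a d k) : SatisfiesStar a (polyP k n d) := by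
  intro l _ _ _
  rw [hypersurfacePoints_polyP]
  apply satisfiesStarOver_of_le
  obtain ⟨m, β, hm, hβ⟩ := hk.exists_root
  rcases n with _ | _ | n
  · exact weakPolySubmodule_le_of_eq_zero
  · exact weakPolySubmodule_le_of_eq_one
  -- The root of unity and the cardinality bound pass from `k` to `l`.
  · exact weakPolySubmodule_le_of_two_le ha (by omega) hd
      (hβ.map_of_injective (algebraMap k l).injective) hm
      (hk.card_gt.trans_le (ENat.card_le_card_of_injective (algebraMap k l).injective))

theorem mainTheorem4 (n d : ℕ) (hd : 1 ≤ d) :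
    (∀ (k : Type u) [Field k],
      (n : ENNReal) / (d : ENNReal) ≤ ((algebraicRank (polyP k n d) : ℕ∞) : ENNReal)) ∧
    (∀ (a : ℕ), 1 ≤ a → ∀ (k : Type u) [Field k], IsAdmissibleField a d k →
      SatisfiesStar a (polyP k n d) ∧
      {f : hypersurfacePoints (polyP k n d) k → k | IsWeaklyPolynomialOfDegreeLE a f} =
        {f : hypersurfacePoints (polyP k n d) k → k | IsPolynomialOfDegreeLE a f}) := by
  refine ⟨fun k _ => div_le_algebraicRank_polyP k n d hd, fun a ha k _ hk => ?_⟩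
  have h := satisfiesStar_polyP (n := n) hd ha k hk
  exact ⟨h, Set.Subset.antisymm (fun f hf => h k f hf)
    fun f hf => IsPolynomialOfDegreeLE.isWeaklyPolynomialOfDegreeLE hf⟩
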